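/- Let $p,\bar p,x$ be positive integers with $\bar p x>2p$. Equip $L=\mathbb Z^2$ with the bilinear form $B(u,v)=u^{T}Av$, $A=\mathrm{diag}(-2p\bar p,\,x)$, extended to $L\otimes\mathbb R$; write $|u|^2=B(u,u)$, $e(z)=e^{2\pi i z}$ and $q=e(\tau)$. Let $d_1=(0,1)$, $d_2=(1,\bar p)$, $c_1=(1,0)$, $c_2=(x,2p)$ and $P=\{\alpha_1d_1+\alpha_2d_2\in L:\alpha_1,\alpha_2\ge 0\}$; then $B$ is positive definite on $P$. For a subset $C$ of $L\otimes\mathbb Q$ put $V_C=\bigoplus_{\lambda\in C}S(\mathfrak h\otimes t^{-1}\mathbb C[t^{-1}])\,e^{\lambda}$, with $\mathfrak h=L\otimes\mathbb C$. The space $V_P$ is the cone vertex operator algebra of $P$: it has the lattice vertex operators and the conformal vector $\omega=\tfrac12\sum_{i,j}(A^{-1})_{ij}\,\varepsilon_i(-1)\varepsilon_j(-1)e^0$ of central charge $c=2$, where $\varepsilon_1,\varepsilon_2$ is the standard basis of $L$; these vertex operators also act on $V_{\gamma+P}$ for $\gamma\in L\otimes\mathbb Q$. Let $\tilde a=\tilde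 a_1d_1+\tilde a_2d_2$ with $\tilde a_i\in\mathbb Q$, $0<\tilde a_i<1$. Put $\tilde a^+=\tilde a$, $\tilde a^-=-\tilde a+d_1+d_2$, and let $V_{\tilde a}=V_{\tilde a^++P}\oplus V_{\tilde a^-+P}$ be the corresponding twisted $V_P$-module. For $b=b_1d_1+b_2d_2$ with $b_i\in\mathbb Q$ let $g_b$ be the automorphism of $V_{\tilde a}$ that multiplies the elements of charge $\lambda\in \tilde a^++P$ of the first summand by $e(B(b,\lambda-\tilde a^+))$ and the elements of charge $\lambda\in \tilde a^-+P$ of the second summand by $-e(B(b,-\lambda-\tilde a^+))$. With $L(0)=\omega_{(1)}$, the space $V_{\tilde a}$ is the sum of its $L(0)$-eigenspaces, these are finite dimensional, and the trace function $$T_{\tilde a,b}(\tau)=\mathrm{Tr}_{V_{\tilde a}}\big(g_b\,q^{L(0)-c/24}\big)$$ converges absolutely for every $\tau$ in the upper half-plane. Let $a\in\mathbb R^2$ be any vector with $a-\tilde a\in\mathbb Zd_1+\mathbb Zd_2$. The regularised indefinite theta series $$\Theta_{A,a,b,c_1,c_2}(\tau)=\sum_{n\in a+\mathbb Z^2}\big(\mathrm{sgn}\,B(c_1,n)-\mathrm{sgn}\,B(c_2,n)\big)\,e(B(n,b))\,q^{|n|^2/2}$$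 converges absolutely, and $$T_{\tilde a,b}(\tau)=-\frac{1}{2\,\eta(\tau)^2}\;e(-B(b,\tilde a))\;\Theta_{A,a,b,c_1,c_2}(\tau),$$ where $\eta$ is the Dedekind eta function. -/

import Mathlib

noncomputable section

namespace ConeVOA

open MvPolynomial

/-! ### The lattice `L = ℤ²` with Gram matrix `A`, and the regularised indefinite theta function -/

/-- The bilinear form `B(x, y) = xᵀ A y`, extended to `K²` for a field `K`. -/
def bil {K : Type*} [Field K] (A : Matrix (Fin 2) (Fin 2) ℤ) (x y : Fin 2 → K) : K :=
  x ⬝ᵥ (A.map (Int.cast : ℤ → K)).mulVec y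

/-- `e(z) = exp(2πi z)`. In particular `q ^ h = e (τ h)` for `q = e(τ)`. -/
def e (z : ℂ) : ℂ := Complex.exp (2 * Real.pi * Complex.I * z)

/-- The regularisation factor `ρ^{c₁,c₂}(n) = sgn B(c₁, n) - sgn B(c₂, n)`. -/
def rho (A : Matrix (Fin 2) (Fin 2) ℤ) (c₁ c₂ n : Fin 2 → ℝ) : ℝ :=
  Real.sign (bil A c₁ n) - Real.sign (bil A c₂ n)

/-- The term of the indefinite theta series at the vector `n`. -/
def thetaTerm (A : Matrix (Fin 2) (Fin 2) ℤ) (b c₁ c₂ : Fin 2 → ℝ) (τ : UpperHalfPlane)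
    (n : Fin 2 → ℝ) : ℂ :=
  (rho A c₁ c₂ n : ℂ) * e (bil A n b : ℝ) * e ((τ : ℂ) * ((bil A n n / 2 : ℝ) : ℂ))

/-- The regularised indefinite theta function
`Θ_{A,a,b,c₁,c₂}(τ) = ∑_{n ∈ a + ℤ²} ρ^{c₁,c₂}(n) e(B(n, b)) q^{B(n, n)/2}`. -/
def theta (A : Matrix (Fin 2) (Fin 2) ℤ) (a b c₁ c₂ : Fin 2 → ℝ) (τ : UpperHalfPlane) : ℂ :=
  ∑' n : Fin 2 → ℤ, thetaTerm A b c₁ c₂ τ (fun i => a i + n i)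

/-! ### Fock space and Heisenberg modes -/

/-- Charges: vectors of `L ⊗ ℚ`, in the standard basis `ε₀, ε₁` of `L = ℤ²`. -/
abbrev Charge := Fin 2 → ℚ

/-- The Fock space `S(𝔥 ⊗ t⁻¹ ℂ[t⁻¹])`, `𝔥 = L ⊗ ℂ`. The variable `X (i, n)` is `εᵢ(-n-1)`. -/
abbrev Fock := MvPolynomial (Fin 2 × ℕ) ℂ

/-- The mode `εᵢ(n)` of the Heisenberg algebra `[h(m), h'(n)] = m B(h, h') δ_{m+n,0}`, acting on the
Fock space of charge `l`. -/
def heis (A : Matrix (Fin 2) (Fin 2) ℤ) (i : Fin 2) : ℤ → Charge → Module.End ℂ Fock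
  | .negSucc n, _ => LinearMap.mulLeft ℂ (X (i, n))
  | .ofNat 0, l => ((bil A (Pi.single i 1) l : ℚ) : ℂ) • 1
  | .ofNat (n + 1), _ =>
      ((n : ℂ) + 1) • ∑ j : Fin 2, (A i j : ℂ) • (pderiv (R := ℂ) (j, n)).toLinearMap

/-- The mode `α(n)` for `α ∈ L ⊗ ℚ`. -/
def heisVec (A : Matrix (Fin 2) (Fin 2) ℤ) (α : Charge) (n : ℤ) (l : Charge) :
    Module.End ℂ Fock :=
  ∑ i : Fin 2, ((α i : ℚ) : ℂ) • heis A i n l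

/-- The sum of a family of operators on Fock space of which all but finitely many vanish on any
given monomial. -/
def locSum {ι : Type*} (f : ι → Module.End ℂ Fock) : Module.End ℂ Fock :=
  (basisMonomials (Fin 2 × ℕ) ℂ).constr ℂ fun d => ∑ᶠ j, f j (monomial d 1)

/-! ### Vertex operators -/

/-- The coefficient of `z ^ k` in `exp f(z)`, for a series `f` without constant term. -/
def expCoeff {R : Type*} [Ring R] [Algebra ℂ R] (f : PowerSeries R) (k : ℕ) : R :=
  ∑ N ∈ Finset.range (k + 1), ((N.factorial : ℂ)⁻¹) • PowerSeries.coeff k (f ^ N)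

/-- The coefficient of `z ^ k` in `exp (∑_{n ≥ 1} α(-n) zⁿ / n)`. -/
def creationExp (A : Matrix (Fin 2) (Fin 2) ℤ) (α l : Charge) (k : ℕ) : Module.End ℂ Fock :=
  expCoeff (PowerSeries.mk fun n : ℕ =>
    if n = 0 then 0 else ((n : ℂ)⁻¹) • heisVec A α (-(n : ℤ)) l) k

/-- The coefficient of `z ^ (-k)` in `exp (-∑_{n ≥ 1} α(n) z⁻ⁿ / n)`. -/
def annihilationExp (A : Matrix (Fin 2) (Fin 2) ℤ) (α l : Charge) (k : ℕ) : Module.End ℂ Fock :=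
  expCoeff (PowerSeries.mk fun n : ℕ =>
    if n = 0 then 0 else (-(n : ℂ)⁻¹) • heisVec A α (n : ℤ) l) k

/-- The Fock space part of the mode `u_(r)` (the coefficient of `z ^ (-r-1)` in `Y(u, z)`) of the
state `u = εᵢ₁(-k₁-1) ⋯ εᵢₛ(-kₛ-1) e^α` on vectors of charge `l`; the charge is raised to `l + α`.

For `u = e^α` this is the coefficient in
`Y(e^α, z) = exp (∑ α(-n) zⁿ / n) exp (-∑ α(n) z⁻ⁿ / n) e^α z^{α(0)}`.
The other states follow from the Borcherds formula
`(h(-k-1) u)_(r) = ∑_{j ≥ 0} (k+j choose j) (h(-k-1-j) u_(r+j) + (-1)^k u_(r-k-1-j) h(j))`.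

No cocycle is needed for the Gram matrices with `A i j ≡ A i i * A j j (mod 2)` for `i ≠ j`, such
as `diag(-2 p p̄, x)`: for them the trivial cocycle gives the lattice vertex (super)algebra. -/
def vertexMode (A : Matrix (Fin 2) (Fin 2) ℤ) (α : Charge) :
    List (Fin 2 × ℕ) → ℚ → Charge → Module.End ℂ Fock
  | [], r, l => locSum fun kj : ℕ × ℕ =>
      if (kj.1 : ℚ) - kj.2 + bil A α l = -r - 1 then
        creationExp A α l kj.1 * annihilationExp A α l kj.2 else 0
  | (i, k) :: w, r, l => locSum fun j : ℕ =>
      ((k + j).choose j : ℂ) •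
        (heis A i (Int.negSucc (k + j)) l * vertexMode A α w (r + j) l +
          (-1 : ℂ) ^ k • (vertexMode A α w (r - k - 1 - j) l * heis A i (j : ℤ) l))

/-! ### Cone vertex algebras and their twisted modules -/

/-- The space `V_C = ⨁_{l ∈ C} S(𝔥 ⊗ t⁻¹ ℂ[t⁻¹]) e^l`. -/
abbrev V (C : Set Charge) := C →₀ Fock

/-- The mode `v_(r)` of `v ∈ V_C` on `V_{C'}`, for `C ⊆ L` and `C' ⊆ L + γ` with `C' + C ⊆ C'`:
the coefficient of `z ^ (-r-1)` in `Y(v, z)`. For `C' = C` this is the vertex algebra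
structure of `V_C`; in general it is the structure of a twisted module on `V_{C'}`. -/
def mode (A : Matrix (Fin 2) (Fin 2) ℤ) {C C' : Set Charge}
    (h : ∀ α ∈ C, ∀ l ∈ C', l + α ∈ C') (v : V C) (r : ℚ) : Module.End ℂ (V C') :=
  v.sum fun α f => ∑ d ∈ f.support, coeff d f •
    Finsupp.lsum ℂ fun l : C' =>
      (Finsupp.lsingle (⟨l.1 + α.1, h _ α.2 _ l.2⟩ : C')) ∘ₗ
        vertexMode A α.1 (Finsupp.toMultiset d).toList r l.1

/-- The Fock space element `½ ∑ (A⁻¹)ᵢⱼ εᵢ(-1) εⱼ(-1)`. -/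
def conformalPoly (A : Matrix (Fin 2) (Fin 2) ℤ) : Fock :=
  ∑ i : Fin 2, ∑ j : Fin 2,
    (((A.map (Int.cast : ℤ → ℚ))⁻¹ i j / 2 : ℚ) : ℂ) • (X (i, 0) * X (j, 0))

/-- The conformal vector `ω = ½ ∑ (A⁻¹)ᵢⱼ εᵢ(-1) εⱼ(-1) e^0` of `V_C`. -/
def conformalVector (A : Matrix (Fin 2) (Fin 2) ℤ) {C : Set Charge} (h0 : (0 : Charge) ∈ C) : V C :=
  Finsupp.single ⟨0, h0⟩ (conformalPoly A)

/-- The Virasoro operator `L(n) = ω_(n+1)` on the `V_C`-module `V_{C'}`. -/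
def virasoro (A : Matrix (Fin 2) (Fin 2) ℤ) {C C' : Set Charge} (h0 : (0 : Charge) ∈ C)
    (h : ∀ α ∈ C, ∀ l ∈ C', l + α ∈ C') (n : ℤ) : Module.End ℂ (V C') :=
  mode A h (conformalVector A h0) (n + 1)

/-- The central charge of `ω`, the rank of the lattice. -/
def centralCharge : ℂ := 2

/-- The operator on `V_C` that multiplies the elements of charge `l` by `φ l`. -/
def phaseOp {C : Set Charge} (φ : Charge → ℂ) : Module.End ℂ (V C) :=
  Finsupp.lsum ℂ fun l : C => φ l.1 • Finsupp.lsingle l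

/-- The cone `P = {∑ αᵢ dᵢ ∈ L | αᵢ ≥ 0}`. -/
def cone (d : Fin 2 → Charge) : Set Charge :=
  {v | (∃ n : Fin 2 → ℤ, ∀ i, v i = n i) ∧ ∃ α : Fin 2 → ℚ, (∀ i, 0 ≤ α i) ∧ v = ∑ i, α i • d i}

/-- The shifted cone `P + γ`. -/
def shiftedCone (d : Fin 2 → Charge) (γ : Charge) : Set Charge :=
  {l | ∃ μ ∈ cone d, l = μ + γ}

theorem zero_mem_cone (d : Fin 2 → Charge) : (0 : Charge) ∈ cone d :=
  ⟨⟨0, by simp⟩, 0, by simp, by simp⟩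

theorem shiftedCone_add (d : Fin 2 → Charge) (γ : Charge) :
    ∀ α ∈ cone d, ∀ l ∈ shiftedCone d γ, l + α ∈ shiftedCone d γ := by
  rintro α ⟨⟨n, hn⟩, s, hs, hα⟩ l ⟨μ, ⟨⟨m, hm⟩, t, ht, hμ⟩, rfl⟩
  refine ⟨μ + α, ⟨⟨m + n, fun i => by simp [hm, hn]⟩, t + s,
    fun i => add_nonneg (ht i) (hs i), ?_⟩, by abel⟩
  rw [hμ, hα, ← Finset.sum_add_distrib]
  simp [add_smul]

/-- `L(0)` on the `V_P`-module `V_{P + γ}`. -/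
def L0 (A : Matrix (Fin 2) (Fin 2) ℤ) (d : Fin 2 → Charge) (γ : Charge) :
    Module.End ℂ (V (shiftedCone d γ)) :=
  virasoro A (zero_mem_cone d) (shiftedCone_add d γ) 0

theorem L0_single (A : Matrix (Fin 2) (Fin 2) ℤ) (d : Fin 2 → Charge) (γ : Charge)
    (l : shiftedCone d γ) (s : Fock) :
    L0 A d γ (Finsupp.single l s) = Finsupp.single l
      (∑ m ∈ (conformalPoly A).support, coeff m (conformalPoly A) •
        vertexMode A 0 (Finsupp.toMultiset m).toList 1 l.1 s) := by
  simp [L0, virasoro, mode, conformalVector, LinearMap.sum_apply, Finsupp.single_finsetSum]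

theorem L0_comm_phaseOp (A : Matrix (Fin 2) (Fin 2) ℤ) (d : Fin 2 → Charge) (γ : Charge)
    (φ : Charge → ℂ) : Commute (L0 A d γ) (phaseOp φ) := by
  refine LinearMap.ext fun v => ?_
  induction v using Finsupp.induction_linear with
  | zero => simp
  | add f g hf hg => rw [map_add, map_add, hf, hg]
  | single l s =>
    have h (t : Fock) : phaseOp φ (Finsupp.single l t) = φ l.1 • Finsupp.single l t := by
      simp [phaseOp]
    rw [Module.End.mul_apply, Module.End.mul_apply, h, map_smul, L0_single, h]

/-- `a⁺ = ∑ aᵢ dᵢ`. -/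
def aPlus (d : Fin 2 → Charge) (a : Fin 2 → ℚ) : Charge := ∑ i, a i • d i

/-- `a⁻ = -a⁺ + ∑ dᵢ`. -/
def aMinus (d : Fin 2 → Charge) (a : Fin 2 → ℚ) : Charge := -aPlus d a + ∑ i, d i

/-- The twisted `V_P`-module `V_a = V_{a⁺ + P} ⊕ V_{a⁻ + P}` (an external direct sum). -/
abbrev TwistedModule (d : Fin 2 → Charge) (a : Fin 2 → ℚ) :=
  V (shiftedCone d (aPlus d a)) × V (shiftedCone d (aMinus d a))

/-- `L(0)` on `V_a`. -/
def twistedL0 (A : Matrix (Fin 2) (Fin 2) ℤ) (d : Fin 2 → Charge) (a : Fin 2 → ℚ) :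
    Module.End ℂ (TwistedModule d a) :=
  (L0 A d (aPlus d a)).prodMap (L0 A d (aMinus d a))

/-- The automorphism `g_b` of `V_a`: multiplication by `e(B(b, l - a⁺))` in charge `l ∈ P + a⁺`,
and by `-e(B(b, -l - a⁺))` in charge `l ∈ P + a⁻`. -/
def gAut (A : Matrix (Fin 2) (Fin 2) ℤ) (d : Fin 2 → Charge) (a : Fin 2 → ℚ) (b : Charge) :
    Module.End ℂ (TwistedModule d a) :=
  (phaseOp fun l => e (bil A b (l - aPlus d a) : ℚ)).prodMap
    (phaseOp fun l => -e (bil A b (-l - aPlus d a) : ℚ))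

theorem twistedL0_comm_gAut (A : Matrix (Fin 2) (Fin 2) ℤ) (d : Fin 2 → Charge) (a : Fin 2 → ℚ)
    (b : Charge) : Commute (twistedL0 A d a) (gAut A d a b) := by
  have h₁ := L0_comm_phaseOp A d (aPlus d a) fun l => e (bil A b (l - aPlus d a) : ℚ)
  have h₂ := L0_comm_phaseOp A d (aMinus d a) fun l => -e (bil A b (-l - aPlus d a) : ℚ)
  refine LinearMap.ext fun v => Prod.ext ?_ ?_
  · exact LinearMap.congr_fun h₁ v.1
  · exact LinearMap.congr_fun h₂ v.2

/-- `Tr(g | W[h]) q^{h - c/24}` for the `L(0)`-eigenspace `W[h]`. -/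
def traceTerm {W : Type*} [AddCommGroup W] [Module ℂ W] {T g : Module.End ℂ W} (hc : Commute T g)
    (c : ℂ) (τ : UpperHalfPlane) (h : ℂ) : ℂ :=
  LinearMap.trace ℂ (T.eigenspace h)
    (g.restrict (Module.End.mapsTo_genEigenspace_of_comm hc h 1)) * e ((τ : ℂ) * (h - c / 24))

/-- The trace function `T_{a,b}(τ) = Tr_{V_a} (g_b q^{L(0) - c/24})`. -/
def traceFunction (A : Matrix (Fin 2) (Fin 2) ℤ) (d : Fin 2 → Charge) (a : Fin 2 → ℚ) (b : Charge)
    (τ : UpperHalfPlane) : ℂ :=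
  ∑' h : ℂ, traceTerm (twistedL0_comm_gAut A d a b) centralCharge τ h

end ConeVOA

end

/-! Both sides are the same sum over two opposite quadrants of `ã + ℤ²`.

Trace side: the vectors (monomial of Fock space) ⊗ `e^λ` form a basis of the twisted module. Since
`A` is diagonal, each of them is an eigenvector of `L(0)`, with eigenvalue `B(λ, λ)/2` plus the
weight of the monomial (`L0_single_monomial`). They are also eigenvectors of `g_b`. Once the sum
over this basis converges absolutely, it can be grouped by eigenvalue (`hasSum_traceTerm`) and
factors as (Fock character) × (sum over charges). The Fock character is `1/η²`, because two
variables occur in each positive degree. As `d₁, d₂` is a `ℤ`-basis of `L`, the charges of the first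
summand are the points of `ã + ℤ²` with both coordinates positive. The negated charges of the second
summand are those with both coordinates negative. The sign in `g_b` on the second summand turns the
charge sum into the difference `posSum - negSum`, up to the phase `e(-B(b, ã))`
(`hasSum_twistedBasis`).

Theta side: `c₁` is orthogonal to `d₁` and `c₂` to `d₂`, so at `n = s d₁ + t d₂` the regularising
factor is `-(sgn s + sgn t)` (`thetaTerm_coneVec`). It is `-2` or `2` when the signs of `s, t` agree
and `0` when they differ; neither coordinate vanishes, because `0 < ãᵢ < 1`. Hence `Θ = -2 (posSum -
negSum)` (`hasSum_thetaTerm`).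

Convergence on both sides comes from `B(n, n) ≥ s² + t²` for `s t ≥ 0` (`le_bil_coneVec`). -/

namespace ConeVOA

/-! ### Traces of simultaneously diagonal operators -/

section Diagonal

variable {W I : Type*} [AddCommGroup W] [Module ℂ W] (v : Module.Basis I ℂ W)
  {T g : Module.End ℂ W} {ε φ : I → ℂ}

/-- In coordinates, `T x = μ x` says `(ε i - μ) xᵢ = 0` for every `i`, so `x` is supported on the
indices with `ε i = μ`. -/
theorem eigenspace_eq_span (hT : ∀ i, T (v i) = ε i • v i) (μ : ℂ) :
    T.eigenspace μ = Submodule.span ℂ (v '' {i | ε i = μ}) := by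
  have hrepr (x : W) (i : I) : v.repr (T x) i = ε i * v.repr x i := by
    suffices h : Finsupp.lapply i ∘ₗ v.repr.toLinearMap ∘ₗ T =
        ε i • (Finsupp.lapply i ∘ₗ v.repr.toLinearMap) from LinearMap.congr_fun h x
    refine v.ext fun j => ?_
    by_cases h : j = i
    · simp [hT, h]
    · simp [hT, h]
  ext x
  rw [Module.End.mem_eigenspace_iff, Module.Basis.mem_span_image, ← v.repr.injective.eq_iff,
    Finsupp.ext_iff]
  refine forall_congr' fun i => ?_
  rw [hrepr, map_smul, Finsupp.smul_apply, smul_eq_mul, Finset.mem_coe, Finsupp.mem_support_iff]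
  simp only [Set.mem_ofPred_eq, mul_eq_mul_right_iff]
  tauto

theorem iSup_eigenspace_eq_top (hT : ∀ i, T (v i) = ε i • v i) :
    ⨆ μ : ℂ, T.eigenspace μ = ⊤ := by
  rw [eq_top_iff, ← v.span_eq, Submodule.span_le]
  rintro _ ⟨i, rfl⟩
  exact Submodule.mem_iSup_of_mem (ε i) (Module.End.mem_eigenspace_iff.2 (hT i))

theorem finiteDimensional_eigenspace (hT : ∀ i, T (v i) = ε i • v i) {μ : ℂ}
    (hfin : {i | ε i = μ}.Finite) : FiniteDimensional ℂ (T.eigenspace μ) := by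
  rw [eigenspace_eq_span v hT]
  exact FiniteDimensional.span_of_finite ℂ (hfin.image _)

theorem trace_restrict_eigenspace (hT : ∀ i, T (v i) = ε i • v i)
    (hg : ∀ i, g (v i) = φ i • v i) (hc : Commute T g) {μ : ℂ} (hfin : {i | ε i = μ}.Finite) :
    LinearMap.trace ℂ (T.eigenspace μ)
      (g.restrict (Module.End.mapsTo_genEigenspace_of_comm hc μ 1)) =
      ∑' i : {i | ε i = μ}, φ i := by
  classical
  have := hfin.fintype
  let w : {i | ε i = μ} → T.eigenspace μ := fun i =>
    ⟨v i, Module.End.mem_eigenspace_iff.2 (by rw [hT, i.2])⟩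
  have hli : LinearIndependent ℂ w := by
    refine LinearIndependent.of_comp (T.eigenspace μ).subtype ?_
    exact v.linearIndependent.comp _ Subtype.val_injective
  have hsp : ⊤ ≤ Submodule.span ℂ (Set.range w) := by
    rw [← Submodule.map_le_map_iff_of_injective (T.eigenspace μ).injective_subtype,
      Submodule.map_span, Submodule.map_top, Submodule.range_subtype, ← Set.range_comp]
    refine (eigenspace_eq_span v hT μ).le.trans (Submodule.span_mono ?_)
    rintro _ ⟨i, hi, rfl⟩
    exact ⟨⟨i, hi⟩, rfl⟩
  let u := Module.Basis.mk hli hsp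
  have hu (i) : u i = w i := Module.Basis.mk_apply hli hsp i
  rw [LinearMap.trace_eq_matrix_trace ℂ u, tsum_fintype, Matrix.trace]
  refine Finset.sum_congr rfl fun i _ => ?_
  have hgu : g.restrict (Module.End.mapsTo_genEigenspace_of_comm hc μ 1) (u i) = φ i • u i := by
    rw [hu]
    exact Subtype.ext (hg i)
  rw [Matrix.diag_apply, LinearMap.toMatrix_apply]
  erw [hgu]
  rw [map_smul, u.repr_self]
  simp

/-- An unconditional sum over the basis may be summed along the fibres of `ε`. The fibre over `μ` is
finite and contributes the trace of `g` on the `μ`-eigenspace. -/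
theorem hasSum_traceTerm (hT : ∀ i, T (v i) = ε i • v i)
    (hg : ∀ i, g (v i) = φ i • v i) (hc : Commute T g)
    (hfin : ∀ μ, {i | ε i = μ}.Finite) {c : ℂ} {τ : UpperHalfPlane} {S : ℂ}
    (hS : HasSum (fun i => φ i * e ((τ : ℂ) * (ε i - c / 24))) S) :
    HasSum (traceTerm hc c τ) S := by
  have h₁ := (Equiv.sigmaFiberEquiv ε).hasSum_iff.2 hS
  refine h₁.sigma fun μ => ?_
  have : Fintype {i // ε i = μ} := (hfin μ).fintype
  rw [traceTerm, trace_restrict_eigenspace v hT hg hc (hfin μ), ← tsum_mul_right]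
  convert (hasSum_fintype _ : HasSum (fun i : {i // ε i = μ} =>
    φ i * e ((τ : ℂ) * (μ - c / 24))) _) using 1
  · funext i
    simp [Equiv.sigmaFiberEquiv, i.2]
  · exact tsum_fintype (β := {i // ε i = μ}) (L := .unconditional _) _

end Diagonal

/-! ### Generating function of multisets -/

section Product

variable {ι 𝕜 : Type*} [NormedField 𝕜] {z : ι → 𝕜}

/-- Splitting off the exponent of one variable. -/
noncomputable def finsuppInsertEquiv [DecidableEq ι] {a : ι} {s : Finset ι} (ha : a ∉ s) :
    {d : ι →₀ ℕ // d.support ⊆ s} × ℕ ≃ {d : ι →₀ ℕ // d.support ⊆ insert a s} where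
  toFun x := ⟨x.1.1.update a x.2, by
    intro i hi
    rcases eq_or_ne i a with rfl | h
    · simp
    · rw [Finsupp.mem_support_iff, Finsupp.update_apply, if_neg h,
        ← Finsupp.mem_support_iff] at hi
      exact Finset.mem_insert_of_mem (x.1.2 hi)⟩
  invFun d := (⟨d.1.erase a, by
    rw [Finsupp.support_erase]
    intro i hi
    exact (Finset.mem_insert.1 (d.2 (Finset.mem_of_mem_erase hi))).resolve_left
      (Finset.ne_of_mem_erase hi)⟩, d.1 a)
  left_inv x := by
    have h : x.1.1 a = 0 := Finsupp.notMem_support_iff.1 fun h => ha (x.1.2 h)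
    refine Prod.ext (Subtype.ext (Finsupp.ext fun i => ?_)) ?_
    · rcases eq_or_ne i a with rfl | hi
      · simp [h]
      · simp [hi]
    · simp
  right_inv d := by
    exact Subtype.ext (Finsupp.ext fun i => by simp)

theorem prod_pow_update [DecidableEq ι] {a : ι} {s : Finset ι} (ha : a ∉ s)
    (x : {d : ι →₀ ℕ // d.support ⊆ s} × ℕ) :
    (finsuppInsertEquiv ha x).1.prod (fun i k => z i ^ k) =
      (x.1.1.prod fun i k => z i ^ k) * z a ^ x.2 := by
  rw [Finsupp.prod_of_support_subset _ (finsuppInsertEquiv ha x).2 _ (by simp),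
    Finsupp.prod_of_support_subset _ x.1.2 _ (by simp), Finset.prod_insert ha, mul_comm]
  congr 1
  · refine Finset.prod_congr rfl fun i hi => ?_
    have : i ≠ a := fun h => ha (h ▸ hi)
    simp [finsuppInsertEquiv, this, Finsupp.update_apply]
  · simp [finsuppInsertEquiv]

/-- Induction on the set of variables: each new variable multiplies the sum by one geometric series.
-/
theorem summable_tsum_prod_pow_support_subset [CompleteSpace 𝕜] (hz : ∀ i, ‖z i‖ < 1)
    (s : Finset ι) :
    Summable (fun d : {d : ι →₀ ℕ // d.support ⊆ s} => ‖d.1.prod fun i k => z i ^ k‖) ∧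
      ∑' d : {d : ι →₀ ℕ // d.support ⊆ s}, (d.1.prod fun i k => z i ^ k) =
        ∏ i ∈ s, (1 - z i)⁻¹ := by
  classical
  induction s using Finset.induction_on with
  | empty =>
    have : Unique {d : ι →₀ ℕ // d.support ⊆ ∅} :=
      ⟨⟨⟨0, by simp⟩⟩, fun d => Subtype.ext (by simpa using d.2)⟩
    refine ⟨Summable.of_finite, ?_⟩
    rw [tsum_fintype, Fintype.sum_unique]
    have : (default : {d : ι →₀ ℕ // d.support ⊆ ∅}).1 = 0 := by
      simpa using (default : {d : ι →₀ ℕ // d.support ⊆ ∅}).2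
    rw [this]
    simp
  | insert a s ha ih =>
    have hgeom : Summable fun n : ℕ => ‖z a ^ n‖ := by
      simpa using summable_geometric_of_lt_one (norm_nonneg _) (hz a)
    constructor
    · rw [← (finsuppInsertEquiv ha).summable_iff]
      refine (ih.1.mul_norm hgeom).congr fun x => ?_
      simp only [Function.comp_apply, prod_pow_update ha]
    · rw [← (finsuppInsertEquiv ha).tsum_eq]
      simp_rw [prod_pow_update ha]
      rw [← tsum_mul_tsum_of_summable_norm ih.1 hgeom, ih.2, Finset.prod_insert ha, mul_comm,
        tsum_geometric_of_norm_lt_one (hz a)]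

/-- Finitely many exponent vectors involve finitely many variables, so a partial sum is at most a
finite product of geometric series. The exponential bound on that product does not depend on the
variables involved. -/
theorem summable_norm_prod_pow {r : ℝ} (hr : r < 1) (hz : ∀ i, ‖z i‖ ≤ r)
    (hs : Summable fun i => ‖z i‖) :
    Summable fun d : ι →₀ ℕ => ‖d.prod fun i k => z i ^ k‖ := by
  classical
  refine summable_of_sum_le (c := Real.exp (∑' i, ‖z i‖ * (1 - r)⁻¹)) (fun _ => norm_nonneg _)
    fun u => ?_
  set s : Finset ι := u.biUnion Finsupp.support with hs'
  have hz1 : ∀ i, ‖‖z i‖‖ < 1 := fun i => by simpa using (hz i).trans_lt hr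
  obtain ⟨h₁, h₂⟩ := summable_tsum_prod_pow_support_subset hz1 s
  have hnorm (d : ι →₀ ℕ) : ‖d.prod fun i k => z i ^ k‖ = d.prod fun i k => ‖z i‖ ^ k := by
    simp [Finsupp.prod]
  have h₁' : Summable fun d : {d : ι →₀ ℕ // d.support ⊆ s} => d.1.prod fun i k => ‖z i‖ ^ k :=
    h₁.of_norm
  calc ∑ d ∈ u, ‖d.prod fun i k => z i ^ k‖
      = ∑ d ∈ u.subtype fun d => d.support ⊆ s, (d.1.prod fun i k => ‖z i‖ ^ k) := by
        rw [Finset.sum_subtype_of_mem (fun d : ι →₀ ℕ => d.prod fun i k => ‖z i‖ ^ k)]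
        · exact Finset.sum_congr rfl fun d _ => hnorm d
        · exact fun d hd => Finset.subset_biUnion_of_mem Finsupp.support hd
    _ ≤ ∑' d : {d : ι →₀ ℕ // d.support ⊆ s}, (d.1.prod fun i k => ‖z i‖ ^ k) :=
        h₁'.sum_le_tsum _ fun d _ => Finset.prod_nonneg fun _ _ => by positivity
    _ = ∏ i ∈ s, (1 - ‖z i‖)⁻¹ := h₂
    _ ≤ ∏ i ∈ s, Real.exp (‖z i‖ * (1 - r)⁻¹) := by
        refine Finset.prod_le_prod (fun i _ => ?_) fun i _ => ?_
        · exact inv_nonneg.2 (by linarith [hz i])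
        -- With `u = ‖z i‖ ≤ r`: `1/(1 - u) = 1 + u/(1 - u) ≤ 1 + u/(1 - r) ≤ exp (u/(1 - r))`.
        · refine le_trans ?_ (Real.add_one_le_exp _)
          have h1 : 0 < 1 - ‖z i‖ := by linarith [hz i]
          have h2 : (1 - ‖z i‖)⁻¹ = ‖z i‖ * (1 - ‖z i‖)⁻¹ + 1 := by field_simp; ring
          rw [h2]
          gcongr
          exact hz i
    _ = Real.exp (∑ i ∈ s, ‖z i‖ * (1 - r)⁻¹) := (Real.exp_sum _ _).symm
    _ ≤ _ := Real.exp_le_exp.2 ((hs.mul_right _).sum_le_tsum _ fun i _ =>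
        mul_nonneg (norm_nonneg _) (inv_nonneg.2 (by linarith)))

/-- The generating function of multisets is an infinite product of geometric series. -/
theorem hasProd_inv_one_sub [CompleteSpace 𝕜] {r : ℝ} (hr : r < 1) (hz : ∀ i, ‖z i‖ ≤ r)
    (hs : Summable fun i => ‖z i‖) :
    HasProd (fun i => (1 - z i)⁻¹) (∑' d : ι →₀ ℕ, d.prod fun i k => z i ^ k) := by
  classical
  have h (s : Finset ι) : ∏ i ∈ s, (1 - z i)⁻¹ = ∑' d : ι →₀ ℕ,
      Set.indicator {d | d.support ⊆ s} (fun d => d.prod fun i k => z i ^ k) d := by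
    rw [← (summable_tsum_prod_pow_support_subset (fun i => (hz i).trans_lt hr) s).2]
    exact tsum_subtype {d : ι →₀ ℕ | d.support ⊆ s} fun d => d.prod fun i k => z i ^ k
  rw [HasProd]
  simp_rw [h]
  -- A partial product over `s` sums the exponents supported in `s`; the full series of norms
  -- dominates all of these sums.
  refine tendsto_tsum_of_dominated_convergence (summable_norm_prod_pow hr hz hs) (fun d => ?_) ?_
  · refine tendsto_const_nhds.congr' ?_
    filter_upwards [Filter.eventually_ge_atTop d.support] with s hs
    rw [Set.indicator_of_mem]
    exact hs
  · exact .of_forall fun s d => norm_indicator_le_norm_self _ _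

end Product

/-! ### The action of `L(0)` on monomials -/

section Virasoro

open MvPolynomial

variable {ι : Type*}

theorem locSum_monomial (f : ι → Module.End ℂ Fock) (d : Fin 2 × ℕ →₀ ℕ) :
    locSum f (monomial d 1) = ∑ᶠ j, f j (monomial d 1) := by
  have h := (basisMonomials (Fin 2 × ℕ) ℂ).constr_basis ℂ (fun d => ∑ᶠ j, f j (monomial d 1)) d
  rwa [coe_basisMonomials] at h

theorem fock_end_ext {f g : Module.End ℂ Fock}
    (h : ∀ d : Fin 2 × ℕ →₀ ℕ, f (monomial d 1) = g (monomial d 1)) : f = g :=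
  (basisMonomials (Fin 2 × ℕ) ℂ).ext fun d => by simpa using h d

theorem locSum_eq_single {f : ι → Module.End ℂ Fock} (j : ι) (h : ∀ k, k ≠ j → f k = 0) :
    locSum f = f j := by
  refine fock_end_ext fun d => ?_
  rw [locSum_monomial, finsum_eq_single _ j fun k hk => by rw [h k hk, LinearMap.zero_apply]]

theorem expCoeff_zero {R : Type*} [Ring R] [Algebra ℂ R] (k : ℕ) :
    expCoeff (0 : PowerSeries R) k = if k = 0 then 1 else 0 := by
  rw [expCoeff, Finset.sum_eq_single 0]
  · simp [PowerSeries.coeff_one]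
  · intro N _ hN
    simp [hN]
  · simp

variable (A : Matrix (Fin 2) (Fin 2) ℤ) (l : Charge)

theorem creationExp_zero (k : ℕ) : creationExp A 0 l k = if k = 0 then 1 else 0 := by
  rw [creationExp, ← expCoeff_zero]
  congr
  ext n
  simp [heisVec]

theorem annihilationExp_zero (k : ℕ) : annihilationExp A 0 l k = if k = 0 then 1 else 0 := by
  rw [annihilationExp, ← expCoeff_zero]
  congr
  ext n
  simp [heisVec]

/-- This is `Y(e^0, z) = 1`: both exponentials are trivial, so only the pair `(0, 0)` contributes.
-/
theorem vertexMode_nil (r : ℚ) : vertexMode A 0 [] r l = if r = -1 then 1 else 0 := by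
  rw [vertexMode, locSum_eq_single (0, 0)]
  · have : (0 : ℚ) = -r - 1 ↔ r = -1 := ⟨fun h => by linarith, fun h => by linarith⟩
    simp [creationExp_zero, annihilationExp_zero, bil, this]
  · rintro ⟨k, j⟩ h
    rw [Ne, Prod.mk.injEq, not_and_or] at h
    rcases h with h | h <;> simp [creationExp_zero, annihilationExp_zero, h]

/-- In the Borcherds formula the vacuum mode leaves a single term: `j = n` in the annihilation half
if `n ≥ 0`, and `j = -n - 1` in the creation half if `n < 0`. -/
theorem vertexMode_singleton (i : Fin 2) (n : ℤ) :
    vertexMode A 0 [(i, 0)] n l = heis A i n l := by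
  rw [vertexMode]
  simp only [vertexMode_nil]
  obtain ⟨m, rfl⟩ | ⟨m, rfl⟩ : (∃ m : ℕ, n = m) ∨ ∃ m, n = Int.negSucc m := by
    cases n with
    | ofNat m => exact .inl ⟨m, rfl⟩
    | negSucc m => exact .inr ⟨m, rfl⟩
  · have h₁ (j : ℕ) : ¬ (((m : ℤ) : ℚ) + j = -1) := by
      intro h
      have : (0 : ℚ) ≤ ((m : ℤ) : ℚ) + j := by positivity
      linarith
    have h₂ (j : ℕ) : ((m : ℤ) : ℚ) - (0 : ℕ) - 1 - j = -1 ↔ j = m := by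
      rw [← @Nat.cast_inj ℚ]
      push_cast
      constructor <;> intro h <;> linarith
    rw [locSum_eq_single m]
    · simp only [h₁, h₂]
      simp
    · intro k hk
      simp only [h₁, h₂, hk]
      simp
  · have h₁ (j : ℕ) : ((Int.negSucc m : ℤ) : ℚ) + j = -1 ↔ j = m := by
      rw [← @Nat.cast_inj ℚ]
      push_cast [Int.negSucc_eq]
      constructor <;> intro h <;> linarith
    have h₂ (j : ℕ) : ¬ (((Int.negSucc m : ℤ) : ℚ) - (0 : ℕ) - 1 - j = -1) := by
      intro h
      push_cast [Int.negSucc_eq] at h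
      have : (0 : ℚ) ≤ (m : ℚ) + j := by positivity
      linarith
    rw [locSum_eq_single m]
    · simp only [h₁, h₂]
      simp
    · intro k hk
      simp only [h₁, h₂, hk]
      simp

/-- When row `i` of `A` is diagonal, `εᵢ(n+1)` is `(n+1) Aᵢᵢ` times the derivative in `X (i, n)`,
and the product is a multiple of the Euler operator `X ∂/∂X`. -/
theorem heis_creation_annihilation {A : Matrix (Fin 2) (Fin 2) ℤ} {i : Fin 2}
    (hA : ∀ j, j ≠ i → A i j = 0) (n : ℕ) (d : Fin 2 × ℕ →₀ ℕ) :
    heis A i (Int.negSucc n) l (heis A i ((n : ℤ) + 1) l (monomial d 1)) =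
      ((n + 1) * A i i * d (i, n) : ℂ) • monomial d (1 : ℂ) := by
  have h₁ : heis A i ((n : ℤ) + 1) l (monomial d 1) =
      ((n + 1) * A i i * d (i, n) : ℂ) • monomial (d - Finsupp.single (i, n) 1) (1 : ℂ) := by
    change (((n : ℂ) + 1) • ∑ j : Fin 2,
      (A i j : ℂ) • (pderiv (R := ℂ) (j, n)).toLinearMap) (monomial d 1) = _
    rw [LinearMap.smul_apply, LinearMap.sum_apply, Finset.sum_eq_single i]
    · simp [pderiv_monomial, smul_monomial, mul_assoc]
    · intro j _ hj
      simp [hA j hj]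
    · simp
  rw [h₁, map_smul]
  change _ • (X (i, n) * monomial (d - Finsupp.single (i, n) 1) (1 : ℂ)) = _
  -- The subtraction of exponents is truncated, but where it truncates the scalar `d (i, n)` is
  -- zero.
  rcases Nat.eq_zero_or_pos (d (i, n)) with h | h
  · simp [h]
  · rw [X, monomial_mul, add_tsub_cancel_of_le, one_mul]
    simpa using Nat.succ_le_of_lt h

/-- The mode is the normally ordered sum over `j ≥ 0` of `εᵢ(-j-1) εᵢ(j+1) + εᵢ(-j) εᵢ(j)`. Each
creation–annihilation pair occurs twice, whence the factor `2`, and `j = 0` in the second family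
gives the square of the zero mode. -/
theorem vertexMode_pair {A : Matrix (Fin 2) (Fin 2) ℤ} {i : Fin 2}
    (hA : ∀ j, j ≠ i → A i j = 0) {N : ℕ} {d : Fin 2 × ℕ →₀ ℕ} (hN : ∀ n, N ≤ n → d (i, n) = 0) :
    vertexMode A 0 [(i, 0), (i, 0)] 1 l (monomial d 1) =
      (2 * A i i * (∑ n ∈ Finset.range N, (n + 1) * d (i, n) : ℂ) + (A i i * l i) ^ 2 : ℂ) •
        monomial d (1 : ℂ) := by
  have hbil : bil A (Pi.single i 1) l = A i i * l i := by
    rw [bil, single_one_dotProduct, Matrix.mulVec, dotProduct, Finset.sum_eq_single i]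
    · simp
    · intro j _ hj
      simp [hA j hj]
    · simp
  have hterm (j : ℕ) : (((0 + j).choose j : ℂ) • (heis A i (Int.negSucc (0 + j)) l *
      vertexMode A 0 [(i, 0)] (1 + j) l + (-1 : ℂ) ^ 0 •
        (vertexMode A 0 [(i, 0)] (1 - (0 : ℕ) - 1 - j) l * heis A i (j : ℤ) l))) (monomial d 1) =
      ((j + 1) * A i i * d (i, j) : ℂ) • monomial d (1 : ℂ) +
      (if j = 0 then (A i i * l i) ^ 2 else j * A i i * d (i, j - 1) : ℂ) •
        monomial d (1 : ℂ) := by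
    have e₁ : (1 + j : ℚ) = ((j + 1 : ℤ) : ℚ) := by push_cast; ring
    have e₂ : (1 - (0 : ℕ) - 1 - j : ℚ) = ((-j : ℤ) : ℚ) := by push_cast; ring
    rw [e₁, e₂, vertexMode_singleton, vertexMode_singleton]
    simp only [zero_add, Nat.choose_self, Nat.cast_one, one_smul, pow_zero, LinearMap.add_apply,
      Module.End.mul_apply, heis_creation_annihilation l hA]
    congr 1
    cases j with
    | zero =>
      change (((bil A (Pi.single i 1) l : ℚ) : ℂ) • (1 : Module.End ℂ Fock))
        ((((bil A (Pi.single i 1) l : ℚ) : ℂ) • (1 : Module.End ℂ Fock)) (monomial d 1)) = _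
      simp [hbil, smul_smul, sq]
    | succ n =>
      have := heis_creation_annihilation l hA n d
      rw [if_neg (Nat.succ_ne_zero n), Nat.add_sub_cancel]
      push_cast
      rw [← this]
      rfl
  rw [vertexMode, locSum_monomial]
  simp only [hterm]
  -- The second family is shifted by one index, so `N + 1` terms are needed. The surplus last term
  -- of the first family is zero.
  rw [finsum_eq_sum_of_support_subset (s := Finset.range (N + 1))]
  · simp only [← add_smul]
    rw [← Finset.sum_smul, Finset.sum_add_distrib, Finset.sum_range_succ, hN N le_rfl,
      Finset.sum_range_succ' (fun j => if j = 0 then _ else _)]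
    congr 1
    simp only [Nat.succ_ne_zero, if_false, if_true, Nat.add_sub_cancel, Finset.mul_sum]
    push_cast
    rw [mul_zero, add_zero, ← add_assoc, ← Finset.sum_add_distrib]
    congr 1
    exact Finset.sum_congr rfl fun n _ => by ring
  · intro j hj
    by_contra h
    rw [Finset.coe_range, Set.mem_Iio, not_lt] at h
    have h₁ : d (i, j) = 0 := hN j (by omega)
    have h₂ : d (i, j - 1) = 0 := hN (j - 1) (by omega)
    have h₃ : j ≠ 0 := by omega
    simp [h₁, h₂, h₃] at hj

/-- The weight `∑ (n + 1) d(i, n)` of a monomial of Fock space. -/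
def fockWeight (d : Fin 2 × ℕ →₀ ℕ) : ℕ := d.sum fun j k => k * (j.2 + 1)

theorem fockWeight_eq {d : Fin 2 × ℕ →₀ ℕ} {N : ℕ} (hN : ∀ i n, N ≤ n → d (i, n) = 0) :
    fockWeight d = ∑ i : Fin 2, ∑ n ∈ Finset.range N, (n + 1) * d (i, n) := by
  rw [fockWeight, Finsupp.sum_of_support_subset (s := Finset.univ ×ˢ Finset.range N),
    Finset.sum_product]
  · simp [mul_comm]
  · rintro ⟨i, n⟩ h
    rw [Finsupp.mem_support_iff] at h
    simp only [Finset.mem_product, Finset.mem_univ, true_and, Finset.mem_range]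
    by_contra h'
    exact h (hN i n (by omega))
  · simp

/-- `Multiset.toList` chooses an ordering, which is immaterial here since both entries are equal. -/
theorem toList_toMultiset_single_two {α : Type*} (a : α) :
    (Finsupp.toMultiset (Finsupp.single a 2)).toList = [a, a] := by
  rw [Finsupp.toMultiset_single, Multiset.nsmul_singleton]
  change _ = List.replicate 2 a
  rw [← List.perm_replicate, ← Multiset.coe_eq_coe, Multiset.coe_toList, Multiset.coe_replicate]

theorem conformalPoly_diagonal {δ : Fin 2 → ℤ} (hδ : ∀ i, δ i ≠ 0) :
    conformalPoly (Matrix.diagonal δ) =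
      ∑ i, monomial (Finsupp.single (i, 0) 2) ((2 * δ i : ℂ)⁻¹) := by
  have hinv : ((Matrix.diagonal δ).map (Int.cast : ℤ → ℚ))⁻¹ =
      Matrix.diagonal fun i => (δ i : ℚ)⁻¹ := by
    refine Matrix.inv_eq_left_inv ?_
    rw [Matrix.diagonal_map (by simp), Matrix.diagonal_mul_diagonal, ← Matrix.diagonal_one]
    congr 1
    ext i
    exact inv_mul_cancel₀ (by exact_mod_cast hδ i)
  rw [conformalPoly, hinv]
  refine Finset.sum_congr rfl fun i _ => ?_
  rw [Finset.sum_eq_single i]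
  · rw [X, monomial_mul, smul_monomial, ← Finsupp.single_add]
    congr 1
    simp
    ring
  · intro j _ hj
    simp [Matrix.diagonal_apply_ne' _ hj]
  · simp

/-- The coefficient `1/(2 δᵢ)` of the conformal vector turns `2 δᵢ Nᵢ + (δᵢ lᵢ)²` into `Nᵢ + δᵢ
lᵢ²/2`, where `Nᵢ` is the weight carried by the variables `X (i, n)`. -/
theorem L0_single_monomial {δ : Fin 2 → ℤ} (hδ : ∀ i, δ i ≠ 0) (c : Fin 2 → Charge) (γ : Charge)
    (l : shiftedCone c γ) (d : Fin 2 × ℕ →₀ ℕ) :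
    L0 (Matrix.diagonal δ) c γ (Finsupp.single l (monomial d 1)) =
      ((bil (Matrix.diagonal δ) l.1 l.1 / 2 + fockWeight d : ℚ) : ℂ) •
        Finsupp.single l (monomial d (1 : ℂ)) := by
  obtain ⟨N, hN⟩ : ∃ N, ∀ i n, N ≤ n → d (i, n) = 0 := by
    refine ⟨d.support.sup Prod.snd + 1, fun i n hn => ?_⟩
    by_contra h
    have := Finset.le_sup (f := Prod.snd) (Finsupp.mem_support_iff.2 h)
    simp only at this
    omega
  have hne : (Finsupp.single ((0 : Fin 2), 0) 2 : Fin 2 × ℕ →₀ ℕ) ≠ Finsupp.single (1, 0) 2 := by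
    intro h
    simpa using DFunLike.congr_fun h (0, 0)
  have hsupp : (conformalPoly (Matrix.diagonal δ)).support ⊆
      {Finsupp.single (0, 0) 2, Finsupp.single (1, 0) 2} := by
    rw [conformalPoly_diagonal hδ, Fin.sum_univ_two]
    exact support_add.trans (Finset.union_subset_union support_monomial_subset
      support_monomial_subset)
  have hcoeff (i : Fin 2) : coeff (Finsupp.single (i, 0) 2)
      (conformalPoly (Matrix.diagonal δ)) = (2 * δ i : ℂ)⁻¹ := by
    rw [conformalPoly_diagonal hδ, Fin.sum_univ_two, coeff_add, coeff_monomial, coeff_monomial]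
    fin_cases i
    · simp [hne.symm]
    · simp [hne]
  have hpair (i : Fin 2) := vertexMode_pair l.1 (A := Matrix.diagonal δ) (i := i)
    (fun j hj => Matrix.diagonal_apply_ne' _ hj) (hN i)
  rw [L0_single, Finsupp.smul_single, Finset.sum_subset hsupp, Finset.sum_pair hne,
    toList_toMultiset_single_two, toList_toMultiset_single_two, hcoeff, hcoeff, hpair, hpair,
    smul_smul, smul_smul, ← add_smul, fockWeight_eq hN]
  · congr 2
    have h0 : (δ 0 : ℂ) ≠ 0 := by exact_mod_cast hδ 0
    have h1 : (δ 1 : ℂ) ≠ 0 := by exact_mod_cast hδ 1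
    simp only [bil, dotProduct, Matrix.mulVec, Fin.sum_univ_two, Matrix.map_apply,
      Matrix.diagonal_apply_eq]
    rw [Matrix.diagonal_apply_ne _ zero_ne_one, Matrix.diagonal_apply_ne _ one_ne_zero]
    push_cast
    field_simp
    ring
  · intro m _ hm
    rw [notMem_support_iff.1 hm, zero_smul]

end Virasoro

/-! ### The function `e` -/

section Exponential

theorem e_add (z w : ℂ) : e (z + w) = e z * e w := by
  rw [e, mul_add, Complex.exp_add, e, e]

theorem e_ne_zero (z : ℂ) : e z ≠ 0 := Complex.exp_ne_zero _

theorem e_neg (z : ℂ) : e (-z) = (e z)⁻¹ := by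
  rw [e, mul_neg, Complex.exp_neg, e]

theorem e_mul_natCast (z : ℂ) (n : ℕ) : e (z * n) = e z ^ n := by
  rw [e, e, ← Complex.exp_nat_mul]
  congr 1
  ring

theorem norm_e (z : ℂ) : ‖e z‖ = Real.exp (-(2 * Real.pi * z.im)) := by
  rw [e, Complex.norm_exp]
  congr 1
  simp [mul_assoc]

theorem norm_e_ratCast (r : ℚ) : ‖e (r : ℂ)‖ = 1 := by
  simp [norm_e]

theorem norm_e_lt_one (τ : UpperHalfPlane) : ‖e τ‖ < 1 := by
  rw [norm_e, Real.exp_lt_one_iff]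
  have := τ.im_pos
  have : 0 < 2 * Real.pi * (τ : ℂ).im := by simpa using mul_pos Real.two_pi_pos this
  linarith

end Exponential

/-! ### The character of Fock space -/

section FockCharacter

variable (τ : UpperHalfPlane)

theorem e_mul_fockWeight (d : Fin 2 × ℕ →₀ ℕ) :
    e (τ * fockWeight d) = d.prod fun j k => (e τ ^ (j.2 + 1)) ^ k := by
  rw [e_mul_natCast, fockWeight, Finsupp.sum, Finsupp.prod, ← Finset.prod_pow_eq_pow_sum]
  exact Finset.prod_congr rfl fun j _ => by rw [← pow_mul, mul_comm]

theorem norm_e_pow_le (j : Fin 2 × ℕ) : ‖e τ ^ (j.2 + 1)‖ ≤ ‖e τ‖ := by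
  rw [norm_pow]
  exact pow_le_of_le_one (norm_nonneg _) (norm_e_lt_one τ).le j.2.succ_ne_zero

theorem summable_norm_e_pow : Summable fun j : Fin 2 × ℕ => ‖e τ ^ (j.2 + 1)‖ := by
  have h : Summable fun n : ℕ => ‖e τ‖ ^ (n + 1) :=
    (summable_nat_add_iff 1).2 (summable_geometric_of_lt_one (norm_nonneg _) (norm_e_lt_one τ))
  simp_rw [norm_pow]
  refine (summable_prod_of_nonneg fun _ => by positivity).2 ⟨fun _ => h, Summable.of_finite⟩

theorem summable_norm_e_fockWeight :
    Summable fun d : Fin 2 × ℕ →₀ ℕ => ‖e (τ * fockWeight d)‖ := by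
  simp_rw [e_mul_fockWeight]
  exact summable_norm_prod_pow (norm_e_lt_one τ) (norm_e_pow_le τ) (summable_norm_e_pow τ)

theorem eta_q_eq (n : ℕ) : ModularForm.eta_q n τ = e τ ^ (n + 1) := by
  rw [ModularForm.eta_q_eq_pow, e]

theorem tsum_e_fockWeight :
    ∑' d : Fin 2 × ℕ →₀ ℕ, e (τ * fockWeight d) =
      ((∏' n : ℕ, (1 - ModularForm.eta_q n τ)) ^ 2)⁻¹ := by
  simp_rw [e_mul_fockWeight]
  have h₁ := hasProd_inv_one_sub (norm_e_lt_one τ) (norm_e_pow_le τ) (summable_norm_e_pow τ)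
  have h₂ : HasProd (fun n : ℕ => (1 - e τ ^ (n + 1))⁻¹)
      (∏' n : ℕ, (1 - ModularForm.eta_q n τ))⁻¹ := by
    simp_rw [← eta_q_eq]
    refine HasProd.inv₀ (Multipliable.hasProd ?_) (ModularForm.eta_tprod_ne_zero τ.2)
    simp_rw [eta_q_eq]
    exact ModularForm.multipliable_one_sub_pow (norm_e_lt_one τ)
  -- The two copies of the variables, indexed by `Fin 2`, give the same Euler product, hence the
  -- square.
  have h₃ := h₁.prod_fiberwise fun _ : Fin 2 => h₂
  rw [h₃.unique (hasProd_fintype _), Fin.prod_univ_two, ← sq, inv_pow]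

/-- The character of Fock space is `1 / η²`. -/
theorem tsum_e_fockWeight_mul :
    (∑' d : Fin 2 × ℕ →₀ ℕ, e (τ * fockWeight d)) * e (-(τ * (centralCharge / 24))) =
      1 / ModularForm.eta τ ^ 2 := by
  have h : e (τ * (centralCharge / 24)) = Function.Periodic.qParam 24 τ ^ 2 := by
    rw [e, centralCharge, Function.Periodic.qParam, ← Complex.exp_nat_mul]
    congr 1
    push_cast
    ring
  rw [tsum_e_fockWeight, e_neg, h, ModularForm.eta, mul_pow, one_div, mul_inv, mul_comm]

end FockCharacter

/-! ### Diagonalisation of the twisted module -/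

section TwistedModule

open MvPolynomial

variable (c : Fin 2 → Charge) (t : Fin 2 → ℚ)

/-- The basis of `V_C` of monomials. -/
noncomputable def monomialBasis (C : Set Charge) :
    Module.Basis (Σ _ : C, (Fin 2 × ℕ →₀ ℕ)) ℂ (V C) :=
  Finsupp.basis fun _ => basisMonomials (Fin 2 × ℕ) ℂ

theorem monomialBasis_apply {C : Set Charge} (i : Σ _ : C, (Fin 2 × ℕ →₀ ℕ)) :
    monomialBasis C i = Finsupp.single i.1 (monomial i.2 1) := by
  simp [monomialBasis, Finsupp.coe_basis]

/-- Charges and exponents of the monomials in the twisted module. -/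
abbrev TwistedIndex :=
  (Σ _ : shiftedCone c (aPlus c t), (Fin 2 × ℕ →₀ ℕ)) ⊕
    (Σ _ : shiftedCone c (aMinus c t), (Fin 2 × ℕ →₀ ℕ))

noncomputable def twistedBasis : Module.Basis (TwistedIndex c t) ℂ (TwistedModule c t) :=
  (monomialBasis _).prod (monomialBasis _)

/-- The conformal weight of a monomial. -/
noncomputable def conformalWeight (A : Matrix (Fin 2) (Fin 2) ℤ) {C : Set Charge}
    (i : Σ _ : C, (Fin 2 × ℕ →₀ ℕ)) : ℂ :=
  ((bil A i.1.1 i.1.1 / 2 + fockWeight i.2 : ℚ) : ℂ)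

theorem twistedL0_twistedBasis {δ : Fin 2 → ℤ} (hδ : ∀ i, δ i ≠ 0) (i : TwistedIndex c t) :
    twistedL0 (Matrix.diagonal δ) c t (twistedBasis c t i) =
      Sum.elim (conformalWeight (Matrix.diagonal δ)) (conformalWeight (Matrix.diagonal δ)) i •
        twistedBasis c t i := by
  rcases i with i | i
  · simp [twistedBasis, twistedL0, monomialBasis_apply, L0_single_monomial hδ, conformalWeight]
  · simp [twistedBasis, twistedL0, monomialBasis_apply, L0_single_monomial hδ, conformalWeight]

/-- The eigenvalue of `g_b` on a monomial. -/
noncomputable def twistedPhase (A : Matrix (Fin 2) (Fin 2) ℤ) (b : Charge) : TwistedIndex c t → ℂ :=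
  Sum.elim (fun i => e (bil A b (i.1.1 - aPlus c t) : ℚ))
    (fun i => -e (bil A b (-i.1.1 - aPlus c t) : ℚ))

theorem gAut_twistedBasis (A : Matrix (Fin 2) (Fin 2) ℤ) (b : Charge) (i : TwistedIndex c t) :
    gAut A c t b (twistedBasis c t i) = twistedPhase c t A b i • twistedBasis c t i := by
  rcases i with i | i
  · simp [twistedBasis, gAut, monomialBasis_apply, phaseOp, twistedPhase]
  · simp [twistedBasis, gAut, monomialBasis_apply, phaseOp, twistedPhase]

theorem norm_twistedPhase (A : Matrix (Fin 2) (Fin 2) ℤ) (b : Charge) (i : TwistedIndex c t) :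
    ‖twistedPhase c t A b i‖ = 1 := by
  rcases i with i | i <;> simp only [twistedPhase, Sum.elim_inl, Sum.elim_inr, norm_neg,
    norm_e_ratCast]

/-- On a fibre of `ε` the summand has constant nonzero norm, whereas the terms of a summable family
tend to zero along the cofinite filter. Convergence of the character thus yields finite-dimensional
eigenspaces. -/
theorem finite_fiber_of_summable {I : Type*} {ε φ : I → ℂ} {τ : UpperHalfPlane} {c : ℂ}
    (hφ : ∀ i, ‖φ i‖ = 1) (hs : Summable fun i => φ i * e (τ * (ε i - c / 24))) (μ : ℂ) :
    {i | ε i = μ}.Finite := by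
  have h := hs.tendsto_cofinite_zero.norm
  rw [norm_zero] at h
  have h' := h.eventually_lt_const (norm_pos_iff.2 (e_ne_zero (τ * (μ - c / 24))))
  rw [Filter.eventually_cofinite] at h'
  refine h'.subset fun i hi => ?_
  rw [Set.mem_ofPred_eq] at hi
  simp [hφ, hi]

/-- The trace over `V_C` of a phase times `q^{L(0) - c/24}`. -/
theorem hasSum_monomialBasis {A : Matrix (Fin 2) (Fin 2) ℤ} {C : Set Charge} {ψ : Charge → ℂ}
    {τ : UpperHalfPlane}
    (hs : Summable fun l : C => ‖ψ l.1 * e (τ * ((bil A l.1 l.1 / 2 : ℚ) : ℂ))‖) :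
    HasSum (fun i : Σ _ : C, (Fin 2 × ℕ →₀ ℕ) =>
      ψ i.1.1 * e (τ * (conformalWeight A i - centralCharge / 24)))
      (1 / ModularForm.eta τ ^ 2 *
        ∑' l : C, ψ l.1 * e (τ * ((bil A l.1 l.1 / 2 : ℚ) : ℂ))) := by
  have h₁ := (summable_mul_of_summable_norm hs (summable_norm_e_fockWeight τ)).hasSum
  rw [← tsum_mul_tsum_of_summable_norm hs (summable_norm_e_fockWeight τ)] at h₁
  have h₂ := (Equiv.sigmaEquivProd C (Fin 2 × ℕ →₀ ℕ)).hasSum_iff.2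
    (h₁.mul_right (e (-(τ * (centralCharge / 24)))))
  rw [mul_assoc, tsum_e_fockWeight_mul] at h₂
  rw [mul_comm (1 / _)]
  refine (congrArg (HasSum · _) (funext fun i => ?_)).mpr h₂
  simp only [Function.comp_apply, Equiv.sigmaEquivProd_apply, conformalWeight]
  rw [mul_assoc, mul_assoc, ← e_add, ← e_add]
  congr 2
  push_cast
  ring

end TwistedModule

/-! ### Lattice points of the cone -/

section Cone

/-- The generators `d₁ = (0, 1)`, `d₂ = (1, m)` of the cone. -/
def coneGen (m : ℕ) : Fin 2 → Charge := ![![0, 1], ![1, (m : ℚ)]]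

/-- The vector with coordinates `s, t` with respect to `d₁, d₂`. -/
def coneVec (m : ℕ) (s t : ℚ) : Charge := ![t, s + m * t]

theorem sum_smul_coneGen (m : ℕ) (t : Fin 2 → ℚ) :
    ∑ i, t i • coneGen m i = coneVec m (t 0) (t 1) := by
  ext j
  fin_cases j <;> simp [coneGen, coneVec, Fin.sum_univ_two, mul_comm]

/-- The matrix of `d₁, d₂` is unimodular, so a lattice point has integral coordinates: `α 1 = n 0`
and `α 0 = n 1 - m n 0`. -/
theorem mem_cone_coneGen {m : ℕ} {v : Charge} :
    v ∈ cone (coneGen m) ↔ ∃ k : ℕ × ℕ, v = coneVec m k.1 k.2 := by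
  constructor
  · rintro ⟨⟨n, hn⟩, α, hα, rfl⟩
    rw [sum_smul_coneGen] at *
    have h₀ : α 1 = n 0 := hn 0
    have h₁ : α 0 + m * α 1 = n 1 := hn 1
    have h₂ : α 0 = ((n 1 - m * n 0 : ℤ) : ℚ) := by
      push_cast
      rw [← h₁, ← h₀]
      ring
    have h₃ : 0 ≤ n 0 := by
      have := hα 1
      rw [h₀] at this
      exact_mod_cast this
    have h₄ : 0 ≤ n 1 - m * n 0 := by
      have := hα 0
      rw [h₂] at this
      exact_mod_cast this
    refine ⟨((n 1 - m * n 0).toNat, (n 0).toNat), ?_⟩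
    have e₁ : (((n 1 - m * n 0).toNat : ℕ) : ℚ) = ((n 1 - m * n 0 : ℤ) : ℚ) := by
      exact_mod_cast congrArg (Int.cast : ℤ → ℚ) (Int.toNat_of_nonneg h₄)
    have e₂ : (((n 0).toNat : ℕ) : ℚ) = (n 0 : ℚ) := by
      exact_mod_cast congrArg (Int.cast : ℤ → ℚ) (Int.toNat_of_nonneg h₃)
    rw [e₁, e₂, h₀, h₂]
  · rintro ⟨k, rfl⟩
    refine ⟨⟨![k.2, k.1 + m * k.2], fun i => ?_⟩, ![k.1, k.2], fun i => ?_, ?_⟩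
    · fin_cases i <;> simp [coneVec]
    · fin_cases i <;> simp
    · rw [sum_smul_coneGen]
      rfl

theorem coneVec_add (m : ℕ) (s t s' t' : ℚ) :
    coneVec m s t + coneVec m s' t' = coneVec m (s + s') (t + t') := by
  ext j
  fin_cases j
  · rfl
  · change s + m * t + (s' + m * t') = s + s' + m * (t + t')
    ring

theorem neg_coneVec (m : ℕ) (s t : ℚ) : -coneVec m s t = coneVec m (-s) (-t) := by
  ext j
  fin_cases j
  · rfl
  · change -(s + m * t) = -s + m * -t
    ring

theorem coneVec_injective {m : ℕ} {s t s' t' : ℚ} (h : coneVec m s t = coneVec m s' t') :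
    s = s' ∧ t = t' := by
  have h₀ : t = t' := congrFun h 0
  have h₁ : s + m * t = s' + m * t' := congrFun h 1
  subst h₀
  exact ⟨add_right_cancel h₁, rfl⟩

/-- The lattice points of a shifted cone are parametrised by `ℕ × ℕ`. -/
noncomputable def shiftedConeEquiv (m : ℕ) (γ : Charge) :
    ℕ × ℕ ≃ shiftedCone (coneGen m) γ :=
  Equiv.ofBijective (fun k => ⟨coneVec m k.1 k.2 + γ, _, mem_cone_coneGen.2 ⟨k, rfl⟩, rfl⟩) <| by
    constructor
    · intro k k' h
      have h' := coneVec_injective (add_right_cancel (Subtype.ext_iff.1 h))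
      exact Prod.ext (by exact_mod_cast h'.1) (by exact_mod_cast h'.2)
    · rintro ⟨_, _, hμ, rfl⟩
      obtain ⟨k, rfl⟩ := mem_cone_coneGen.1 hμ
      exact ⟨k, rfl⟩

theorem shiftedConeEquiv_apply (m : ℕ) (γ : Charge) (k : ℕ × ℕ) :
    (shiftedConeEquiv m γ k).1 = coneVec m k.1 k.2 + γ := rfl

theorem aPlus_coneGen (m : ℕ) (t : Fin 2 → ℚ) : aPlus (coneGen m) t = coneVec m (t 0) (t 1) :=
  sum_smul_coneGen m t

theorem aMinus_coneGen (m : ℕ) (t : Fin 2 → ℚ) :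
    aMinus (coneGen m) t = coneVec m (1 - t 0) (1 - t 1) := by
  have h := sum_smul_coneGen m 1
  simp only [Pi.one_apply, one_smul] at h
  rw [aMinus, aPlus_coneGen, h, neg_coneVec, coneVec_add]
  congr 1 <;> ring

end Cone

/-! ### Positivity of the form on the cone -/

section Form

/-- The diagonal of the Gram matrix. -/
def gramDiag (x p m : ℕ) : Fin 2 → ℤ := ![-2 * (p : ℤ) * m, (x : ℤ)]

variable {x p m : ℕ}

theorem gramDiag_ne_zero (hp : 0 < p) (hx : 2 * p < m * x) (i : Fin 2) :
    gramDiag x p m i ≠ 0 := by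
  have hm : m ≠ 0 := by rintro rfl; simp at hx
  have hx' : x ≠ 0 := by rintro rfl; simp at hx
  fin_cases i
  · simp [gramDiag, hm, hp.ne']
  · simpa [gramDiag] using hx'

theorem bil_gramDiag {K : Type*} [Field K] (u v : Fin 2 → K) :
    bil (Matrix.diagonal (gramDiag x p m)) u v =
      -2 * p * m * (u 0 * v 0) + x * (u 1 * v 1) := by
  rw [bil, dotProduct, Fin.sum_univ_two, Matrix.mulVec, Matrix.mulVec, dotProduct, dotProduct,
    Fin.sum_univ_two, Fin.sum_univ_two]
  simp [gramDiag]
  ring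

/-- In the coordinates `s, t` the form is `x s² + 2xm st + m(mx - 2p) t²`. By integrality and `2p <
mx` both square coefficients are at least `1`, and the cross term is nonnegative. -/
theorem le_bil_coneVec (hx : 2 * p < m * x) {s t : ℚ} (hst : 0 ≤ s * t) :
    s ^ 2 + t ^ 2 ≤ bil (Matrix.diagonal (gramDiag x p m)) (coneVec m s t) (coneVec m s t) := by
  have hm : m ≠ 0 := by rintro rfl; simp at hx
  have hx' : x ≠ 0 := by rintro rfl; simp at hx
  have h₁ : (1 : ℚ) ≤ m := by exact_mod_cast Nat.one_le_iff_ne_zero.2 hm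
  have h₂ : (1 : ℚ) ≤ x := by exact_mod_cast Nat.one_le_iff_ne_zero.2 hx'
  have h₃ : (1 : ℚ) ≤ m * x - 2 * p := by
    have : (2 * p + 1 : ℚ) ≤ m * x := by exact_mod_cast hx
    linarith
  have h : bil (Matrix.diagonal (gramDiag x p m)) (coneVec m s t) (coneVec m s t) =
      x * s ^ 2 + 2 * x * m * (s * t) + m * (m * x - 2 * p) * t ^ 2 := by
    rw [bil_gramDiag]
    change -2 * (p : ℚ) * m * (t * t) + x * ((s + m * t) * (s + m * t)) = _
    ring
  rw [h]
  have h₄ : (1 : ℚ) ≤ m * (m * x - 2 * p) := one_le_mul_of_one_le_of_one_le h₁ h₃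
  have h₅ : 0 ≤ 2 * x * m * (s * t) := by positivity
  have h₆ := mul_le_mul_of_nonneg_right h₂ (sq_nonneg s)
  have h₇ := mul_le_mul_of_nonneg_right h₄ (sq_nonneg t)
  linarith

theorem bil_pos_of_mem_cone (hx : 2 * p < m * x) {v : Charge} (hv : v ∈ cone (coneGen m))
    (h0 : v ≠ 0) : 0 < bil (Matrix.diagonal (gramDiag x p m)) v v := by
  obtain ⟨⟨k, l⟩, rfl⟩ := mem_cone_coneGen.1 hv
  refine lt_of_lt_of_le ?_ (le_bil_coneVec hx (by positivity))
  refine lt_of_le_of_ne (by positivity) fun h => h0 ?_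
  have h₁ : (k : ℚ) = 0 := by nlinarith [sq_nonneg (k : ℚ), sq_nonneg (l : ℚ)]
  have h₂ : (l : ℚ) = 0 := by nlinarith [sq_nonneg (k : ℚ), sq_nonneg (l : ℚ)]
  simp only [h₁, h₂]
  ext j
  fin_cases j <;> simp [coneVec]

end Form

/-! ### Convergence of the quadrant sums -/

section Theta

variable (x p m : ℕ) (b : Charge) (τ : UpperHalfPlane)

/-- The unsigned term `e(B(b, n)) q^{B(n, n)/2}` at `n = s d₁ + t d₂`. -/
noncomputable def coneTerm (s t : ℚ) : ℂ :=
  e (bil (Matrix.diagonal (gramDiag x p m)) b (coneVec m s t) : ℚ) *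
    e (τ * ((bil (Matrix.diagonal (gramDiag x p m)) (coneVec m s t) (coneVec m s t) / 2 : ℚ) : ℂ))

variable {x p m}

/-- The norm is `exp (-π Im τ · B(n, n))`, and `B(n, n) ≥ s² + t² ≥ k² + l² ≥ k + l`. This gives a
product of two geometric series as a majorant. -/
theorem norm_coneTerm_le (hx : 2 * p < m * x) {s t : ℚ} (hst : 0 ≤ s * t) {k l : ℕ}
    (hk : (k : ℚ) ≤ |s|) (hl : (l : ℚ) ≤ |t|) :
    ‖coneTerm x p m b τ s t‖ ≤
      Real.exp (-(Real.pi * τ.im)) ^ k * Real.exp (-(Real.pi * τ.im)) ^ l := by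
  have h : (k + l : ℚ) ≤
      bil (Matrix.diagonal (gramDiag x p m)) (coneVec m s t) (coneVec m s t) := by
    refine le_trans ?_ (le_bil_coneVec hx hst)
    have hk' : (k : ℚ) ≤ k ^ 2 := by exact_mod_cast Nat.le_self_pow two_ne_zero k
    have hl' : (l : ℚ) ≤ l ^ 2 := by exact_mod_cast Nat.le_self_pow two_ne_zero l
    have hk₂ : (k : ℚ) ^ 2 ≤ s ^ 2 := by
      rw [← sq_abs s]
      gcongr
    have hl₂ : (l : ℚ) ^ 2 ≤ t ^ 2 := by
      rw [← sq_abs t]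
      gcongr
    linarith
  rw [coneTerm, norm_mul, norm_e_ratCast, one_mul, norm_e, ← Real.exp_nat_mul,
    ← Real.exp_nat_mul, ← Real.exp_add, Real.exp_le_exp]
  set B := bil (Matrix.diagonal (gramDiag x p m)) (coneVec m s t) (coneVec m s t)
  have him : ((τ : ℂ) * ((B / 2 : ℚ) : ℂ)).im = τ.im * (B / 2 : ℝ) := by
    rw [show ((B / 2 : ℚ) : ℂ) = ((B / 2 : ℝ) : ℂ) by push_cast; rfl, Complex.im_mul_ofReal]
    rfl
  rw [him]
  have h' : (k + l : ℝ) ≤ B := by exact_mod_cast h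
  have := mul_le_mul_of_nonneg_left h' (mul_pos Real.pi_pos τ.im_pos).le
  linarith

theorem summable_norm_coneTerm (hx : 2 * p < m * x) {s t : ℕ × ℕ → ℚ}
    (hst : ∀ k, 0 ≤ s k * t k) (hs : ∀ k, (k.1 : ℚ) ≤ |s k|) (ht : ∀ k, (k.2 : ℚ) ≤ |t k|) :
    Summable fun k => ‖coneTerm x p m b τ (s k) (t k)‖ := by
  have hr : Real.exp (-(Real.pi * τ.im)) < 1 := by
    rw [Real.exp_lt_one_iff, neg_lt_zero]
    exact mul_pos Real.pi_pos τ.im_pos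
  have hg := summable_geometric_of_lt_one (Real.exp_pos _).le hr
  refine Summable.of_nonneg_of_le (fun _ => norm_nonneg _)
    (fun k => norm_coneTerm_le b τ hx (hst k) (hs k) (ht k)) ?_
  exact hg.mul_of_nonneg hg (fun _ => by positivity) fun _ => by positivity

end Theta

section Bilinear

variable {K : Type*} [Field K] (A : Matrix (Fin 2) (Fin 2) ℤ)

theorem bil_sub_right (u v w : Fin 2 → K) : bil A u (v - w) = bil A u v - bil A u w := by
  rw [bil, Matrix.mulVec_sub, dotProduct_sub, bil, bil]

theorem bil_neg_neg (u : Fin 2 → K) : bil A (-u) (-u) = bil A u u := by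
  rw [bil, Matrix.mulVec_neg, neg_dotProduct_neg, bil]

end Bilinear

/-! ### Sums over the two quadrants of equal signs -/

section Quadrants

theorem hasSum_int_quadrants {f : ℤ × ℤ → ℂ} {S S' : ℂ}
    (h : HasSum (fun k : ℕ × ℕ => f (k.1, k.2)) S)
    (h' : HasSum (fun k : ℕ × ℕ => f (Int.negSucc k.1, Int.negSucc k.2)) S')
    (h₁ : ∀ k l : ℕ, f (k, Int.negSucc l) = 0) (h₂ : ∀ k l : ℕ, f (Int.negSucc k, l) = 0) :
    HasSum f (S + S') := by
  let g : (ℕ × ℕ) ⊕ (ℕ × ℕ) → ℤ × ℤ :=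
    Sum.elim (fun k => (k.1, k.2)) fun k => (Int.negSucc k.1, Int.negSucc k.2)
  have hg : Function.Injective g := by
    rintro (⟨k, l⟩ | ⟨k, l⟩) (⟨k', l'⟩ | ⟨k', l'⟩) h <;> simp [g] at h <;> simp [h]
  refine (hg.hasSum_iff ?_).1 (HasSum.sum (f := f ∘ g) h h')
  rintro ⟨k | k, l | l⟩ hkl
  · exact absurd ⟨.inl (k, l), rfl⟩ hkl
  · exact h₁ k l
  · exact h₂ k l
  · exact absurd ⟨.inr (k, l), rfl⟩ hkl

end Quadrants

variable {x p m : ℕ} (t : Fin 2 → ℚ) (b : Charge) (τ : UpperHalfPlane)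

/-- The sum of `e(B(b, n)) q^{B(n, n)/2}` over the part of `ã + ℤ²` in the cone. -/
noncomputable def posSum (x p m : ℕ) (t : Fin 2 → ℚ) (b : Charge) (τ : UpperHalfPlane) : ℂ :=
  ∑' k : ℕ × ℕ, coneTerm x p m b τ (t 0 + k.1) (t 1 + k.2)

/-- The sum of `e(B(b, n)) q^{B(n, n)/2}` over the part of `ã + ℤ²` in the opposite cone. -/
noncomputable def negSum (x p m : ℕ) (t : Fin 2 → ℚ) (b : Charge) (τ : UpperHalfPlane) : ℂ :=
  ∑' k : ℕ × ℕ, coneTerm x p m b τ (t 0 + (Int.negSucc k.1 : ℤ)) (t 1 + (Int.negSucc k.2 : ℤ))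

section Summability

variable {t} (ht : ∀ i, 0 < t i ∧ t i < 1)
include ht

theorem add_natCast_pos (i : Fin 2) (k : ℕ) : 0 < t i + k := by
  have := (ht i).1
  positivity

theorem add_negSucc_neg (i : Fin 2) (k : ℕ) : t i + (Int.negSucc k : ℤ) < 0 := by
  have := (ht i).2
  have h : (0 : ℚ) ≤ k := k.cast_nonneg
  push_cast [Int.negSucc_eq]
  linarith

theorem summable_norm_posSum (hx : 2 * p < m * x) :
    Summable fun k : ℕ × ℕ => ‖coneTerm x p m b τ (t 0 + k.1) (t 1 + k.2)‖ := by
  have h (i : Fin 2) (k : ℕ) : (k : ℚ) ≤ |t i + k| := by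
    rw [abs_of_pos (add_natCast_pos ht i k)]
    linarith [(ht i).1]
  exact summable_norm_coneTerm b τ hx
    (fun k => (mul_pos (add_natCast_pos ht 0 k.1) (add_natCast_pos ht 1 k.2)).le)
    (fun k => h 0 k.1) fun k => h 1 k.2

theorem summable_norm_negSum (hx : 2 * p < m * x) :
    Summable fun k : ℕ × ℕ => ‖coneTerm x p m b τ
      (t 0 + (Int.negSucc k.1 : ℤ)) (t 1 + (Int.negSucc k.2 : ℤ))‖ := by
  have h (i : Fin 2) (k : ℕ) : (k : ℚ) ≤ |t i + (Int.negSucc k : ℤ)| := by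
    rw [abs_of_neg (add_negSucc_neg ht i k)]
    push_cast [Int.negSucc_eq]
    linarith [(ht i).2]
  exact summable_norm_coneTerm b τ hx
    (fun k => (mul_pos_of_neg_of_neg (add_negSucc_neg ht 0 k.1) (add_negSucc_neg ht 1 k.2)).le)
    (fun k => h 0 k.1) fun k => h 1 k.2

end Summability

/-! ### The trace as a difference of quadrant sums -/

section Trace

theorem plus_charge_term (k : ℕ × ℕ) :
    e (bil (Matrix.diagonal (gramDiag x p m)) b
        ((shiftedConeEquiv m (aPlus (coneGen m) t) k).1 - aPlus (coneGen m) t) : ℚ) *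
      e (τ * ((bil (Matrix.diagonal (gramDiag x p m)) (shiftedConeEquiv m (aPlus (coneGen m) t) k).1
        (shiftedConeEquiv m (aPlus (coneGen m) t) k).1 / 2 : ℚ) : ℂ)) =
    e (-(bil (Matrix.diagonal (gramDiag x p m)) b (aPlus (coneGen m) t) : ℚ)) *
      coneTerm x p m b τ (t 0 + k.1) (t 1 + k.2) := by
  have hl : (shiftedConeEquiv m (aPlus (coneGen m) t) k).1 =
      coneVec m (t 0 + k.1) (t 1 + k.2) := by
    rw [shiftedConeEquiv_apply, aPlus_coneGen, coneVec_add, add_comm (t 0), add_comm (t 1)]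
  rw [hl, bil_sub_right, coneTerm, ← mul_assoc, Rat.cast_sub, sub_eq_neg_add, e_add]

/-- Negation carries `ã⁻ + P` to the negative quadrant of `ã + ℤ²`, since `-(1 - tᵢ + k) = tᵢ + (-k
- 1)`, and it preserves `B(λ, λ)`. -/
theorem minus_charge_term (k : ℕ × ℕ) :
    -e (bil (Matrix.diagonal (gramDiag x p m)) b
        (-(shiftedConeEquiv m (aMinus (coneGen m) t) k).1 - aPlus (coneGen m) t) : ℚ) *
      e (τ * ((bil (Matrix.diagonal (gramDiag x p m))
        (shiftedConeEquiv m (aMinus (coneGen m) t) k).1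
        (shiftedConeEquiv m (aMinus (coneGen m) t) k).1 / 2 : ℚ) : ℂ)) =
    -e (-(bil (Matrix.diagonal (gramDiag x p m)) b (aPlus (coneGen m) t) : ℚ)) *
      coneTerm x p m b τ (t 0 + (Int.negSucc k.1 : ℤ)) (t 1 + (Int.negSucc k.2 : ℤ)) := by
  have hl : -(shiftedConeEquiv m (aMinus (coneGen m) t) k).1 =
      coneVec m (t 0 + (Int.negSucc k.1 : ℤ)) (t 1 + (Int.negSucc k.2 : ℤ)) := by
    rw [shiftedConeEquiv_apply, aMinus_coneGen, coneVec_add, neg_coneVec]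
    congr 1 <;> push_cast [Int.negSucc_eq] <;> ring
  rw [← bil_neg_neg, hl, bil_sub_right, coneTerm, Rat.cast_sub, sub_eq_neg_add, e_add]
  ring

theorem hasSum_twistedBasis (ht : ∀ i, 0 < t i ∧ t i < 1) (hx : 2 * p < m * x) :
    HasSum (fun i : TwistedIndex (coneGen m) t =>
      twistedPhase (coneGen m) t (Matrix.diagonal (gramDiag x p m)) b i *
        e (τ * (Sum.elim (conformalWeight (Matrix.diagonal (gramDiag x p m)))
          (conformalWeight (Matrix.diagonal (gramDiag x p m))) i - centralCharge / 24)))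
      (1 / ModularForm.eta τ ^ 2 *
        (e (-(bil (Matrix.diagonal (gramDiag x p m)) b (aPlus (coneGen m) t) : ℚ)) *
          (posSum x p m t b τ - negSum x p m t b τ))) := by
  set κ := e (-(bil (Matrix.diagonal (gramDiag x p m)) b (aPlus (coneGen m) t) : ℚ)) with hκ
  have hp := hasSum_monomialBasis (A := Matrix.diagonal (gramDiag x p m)) (τ := τ)
    (C := shiftedCone (coneGen m) (aPlus (coneGen m) t))
    (ψ := fun l => e (bil (Matrix.diagonal (gramDiag x p m)) b (l - aPlus (coneGen m) t) : ℚ))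
    (by
      rw [← (shiftedConeEquiv m (aPlus (coneGen m) t)).summable_iff]
      refine ((summable_norm_posSum b τ ht hx).mul_left ‖κ‖).congr fun k => ?_
      rw [Function.comp_apply, plus_charge_term, norm_mul])
  have hm := hasSum_monomialBasis (A := Matrix.diagonal (gramDiag x p m)) (τ := τ)
    (C := shiftedCone (coneGen m) (aMinus (coneGen m) t))
    (ψ := fun l => -e (bil (Matrix.diagonal (gramDiag x p m)) b (-l - aPlus (coneGen m) t) : ℚ))
    (by
      rw [← (shiftedConeEquiv m (aMinus (coneGen m) t)).summable_iff]
      refine ((summable_norm_negSum b τ ht hx).mul_left ‖-κ‖).congr fun k => ?_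
      rw [Function.comp_apply, minus_charge_term, norm_mul])
  rw [← (shiftedConeEquiv m (aPlus (coneGen m) t)).tsum_eq] at hp
  rw [← (shiftedConeEquiv m (aMinus (coneGen m) t)).tsum_eq] at hm
  simp_rw [plus_charge_term] at hp
  simp_rw [minus_charge_term] at hm
  rw [tsum_mul_left, ← hκ] at hp hm
  have hS : 1 / ModularForm.eta τ ^ 2 * (κ * (posSum x p m t b τ - negSum x p m t b τ)) =
      1 / ModularForm.eta τ ^ 2 * (κ * posSum x p m t b τ) +
        1 / ModularForm.eta τ ^ 2 * (-κ * negSum x p m t b τ) := by ring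
  rw [hS]
  exact HasSum.sum hp hm

end Trace

/-! ### The theta series as a difference of quadrant sums -/

section ThetaSeries

/-- Reindexing of `a + ℤ²` by coordinates with respect to `d₁, d₂`. -/
def coneCoordEquiv (m : ℕ) (k : Fin 2 → ℤ) : ℤ × ℤ ≃ (Fin 2 → ℤ) where
  -- The shift by `k` makes `u` the coordinates relative to `ã` rather than to `a = ã + k₀ d₁ + k₁
  -- d₂`.
  toFun u := ![u.2 - k 1, u.1 - k 0 + m * (u.2 - k 1)]
  invFun n := (n 1 - m * n 0 + k 0, n 0 + k 1)
  left_inv u := by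
    ext <;> simp
  right_inv n := by
    ext i
    fin_cases i <;> simp

theorem sign_mul_of_pos {r : ℝ} (hr : 0 < r) (s : ℝ) : Real.sign (r * s) = Real.sign s := by
  rcases lt_trichotomy s 0 with h | rfl | h
  · rw [Real.sign_of_neg h, Real.sign_of_neg (mul_neg_of_pos_of_neg hr h)]
  · simp
  · rw [Real.sign_of_pos h, Real.sign_of_pos (mul_pos hr h)]

/-- Since `B(c₁, d₁) = 0 = B(c₂, d₂)`, each sign depends on one coordinate only: `B(c₁, n) = -2pm t`
and `B(c₂, n) = 2px s`. -/
theorem thetaTerm_coneVec (hp : 0 < p) (hx : 2 * p < m * x) (s t : ℚ) :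
    thetaTerm (Matrix.diagonal (gramDiag x p m)) (fun i => (b i : ℝ)) ![1, 0] ![(x : ℝ), 2 * p] τ
      (fun i => (coneVec m s t i : ℝ)) =
      -((Real.sign s + Real.sign t : ℝ) : ℂ) * coneTerm x p m b τ s t := by
  have hm : 0 < m := Nat.pos_of_ne_zero (by rintro rfl; simp at hx)
  have hx' : 0 < x := Nat.pos_of_ne_zero (by rintro rfl; simp at hx)
  have h₁ : rho (Matrix.diagonal (gramDiag x p m)) ![1, 0] ![(x : ℝ), 2 * p]
      (fun i => (coneVec m s t i : ℝ)) = -(Real.sign s + Real.sign t) := by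
    have e₁ : bil (Matrix.diagonal (gramDiag x p m)) ![1, 0] (fun i => (coneVec m s t i : ℝ)) =
        -((2 * p * m) * (t : ℝ)) := by
      rw [bil_gramDiag]
      simp [coneVec]
    have e₂ : bil (Matrix.diagonal (gramDiag x p m)) ![(x : ℝ), 2 * p]
        (fun i => (coneVec m s t i : ℝ)) = (2 * p * x) * (s : ℝ) := by
      rw [bil_gramDiag]
      simp [coneVec]
      ring
    rw [rho, e₁, e₂, Real.sign_neg, sign_mul_of_pos (by positivity),
      sign_mul_of_pos (by positivity)]
    ring
  have h₂ : ((bil (Matrix.diagonal (gramDiag x p m)) (fun i => (coneVec m s t i : ℝ))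
      (fun i => (b i : ℝ)) : ℝ) : ℂ) =
      (bil (Matrix.diagonal (gramDiag x p m)) b (coneVec m s t) : ℚ) := by
    rw [bil_gramDiag, bil_gramDiag]
    push_cast
    ring
  have h₃ : ((bil (Matrix.diagonal (gramDiag x p m)) (fun i => (coneVec m s t i : ℝ))
      (fun i => (coneVec m s t i : ℝ)) / 2 : ℝ) : ℂ) =
      ((bil (Matrix.diagonal (gramDiag x p m)) (coneVec m s t) (coneVec m s t) / 2 : ℚ) : ℂ) := by
    rw [bil_gramDiag, bil_gramDiag]
    push_cast
    ring
  rw [thetaTerm, h₁, h₂, h₃, coneTerm, mul_assoc]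
  push_cast
  rfl

theorem hasSum_thetaTerm (hp : 0 < p) (hx : 2 * p < m * x) (ht : ∀ i, 0 < t i ∧ t i < 1)
    {a : Fin 2 → ℝ} {k : Fin 2 → ℤ}
    (ha : ∀ j, a j = (aPlus (coneGen m) t j : ℝ) + ∑ i, (k i : ℝ) * (coneGen m i j : ℝ)) :
    HasSum (fun n : Fin 2 → ℤ => thetaTerm (Matrix.diagonal (gramDiag x p m))
      (fun i => (b i : ℝ)) ![1, 0] ![(x : ℝ), 2 * p] τ fun i => a i + n i)
      (-2 * posSum x p m t b τ + 2 * negSum x p m t b τ) := by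
  have hvec (u : ℤ × ℤ) : (fun i => a i + (coneCoordEquiv m k u i : ℝ)) =
      fun i => (coneVec m (t 0 + u.1) (t 1 + u.2) i : ℝ) := by
    ext i
    rw [ha, aPlus_coneGen, Fin.sum_univ_two]
    fin_cases i
    · simp [coneVec, coneGen, coneCoordEquiv]
    · simp [coneVec, coneGen, coneCoordEquiv]
      ring
  rw [← (coneCoordEquiv m k).hasSum_iff]
  -- As `0 < tᵢ < 1`, no coordinate is zero and `Real.sign` never takes the value `0`.
  have hsp (i : Fin 2) (n : ℕ) : Real.sign ((t i + ((n : ℤ) : ℚ) : ℚ) : ℝ) = 1 :=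
    Real.sign_of_pos (by exact_mod_cast add_natCast_pos ht i n)
  have hsn (i : Fin 2) (n : ℕ) : Real.sign ((t i + (Int.negSucc n : ℤ) : ℚ) : ℝ) = -1 :=
    Real.sign_of_neg (by exact_mod_cast add_negSucc_neg ht i n)
  refine hasSum_int_quadrants ?_ ?_ (fun n l => ?_) fun n l => ?_
  · refine (congrArg (HasSum · _) (funext fun n => ?_)).mpr
      ((summable_norm_posSum b τ ht hx).of_norm.hasSum.mul_left (-2))
    rw [Function.comp_apply, hvec, thetaTerm_coneVec b τ hp hx, hsp, hsp]
    push_cast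
    norm_num
  · refine (congrArg (HasSum · _) (funext fun n => ?_)).mpr
      ((summable_norm_negSum b τ ht hx).of_norm.hasSum.mul_left 2)
    rw [Function.comp_apply, hvec, thetaTerm_coneVec b τ hp hx, hsn, hsn]
    norm_num
  · rw [Function.comp_apply, hvec, thetaTerm_coneVec b τ hp hx, hsp, hsn]
    simp
  · rw [Function.comp_apply, hvec, thetaTerm_coneVec b τ hp hx, hsp, hsn]
    simp

end ThetaSeries

end ConeVOA

theorem mainTheorem4 (x p pbar : ℕ) (hp : 0 < p) (hx : 2 * p < pbar * x)
    (A : Matrix (Fin 2) (Fin 2) ℤ) (hA : A = !![-2 * (p : ℤ) * pbar, 0; 0, (x : ℤ)])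
    (d : Fin 2 → ConeVOA.Charge) (hd : d = ![![0, 1], ![1, (pbar : ℚ)]])
    (c₁ c₂ : Fin 2 → ℝ) (hc₁ : c₁ = ![1, 0]) (hc₂ : c₂ = ![(x : ℝ), 2 * p])
    -- the coordinates of `ã` with respect to `d₁, d₂`, and the vector `ã` itself
    (ta : Fin 2 → ℚ) (hta : ∀ i, 0 < ta i ∧ ta i < 1)
    (aT : ConeVOA.Charge) (haT : aT = ∑ i, ta i • d i)
    -- any rational combination `b = ∑ bᵢ dᵢ`
    (b : ConeVOA.Charge) (hb : ∃ β : Fin 2 → ℚ, b = ∑ i, β i • d i)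
    -- any `a` congruent to `ã` modulo `ℤ d₁ + ℤ d₂`
    (a : Fin 2 → ℝ)
    (ha : ∃ k : Fin 2 → ℤ, ∀ j, a j = (aT j : ℝ) + ∑ i, (k i : ℝ) * (d i j : ℝ)) :
    -- `B` is positive definite on the cone
    (∀ v ∈ ConeVOA.cone d, v ≠ 0 → 0 < ConeVOA.bil A v v) ∧
    -- `V_ã` is the sum of its `L(0)`-eigenspaces, and these have finite dimension
    (⨆ h : ℂ, (ConeVOA.twistedL0 A d ta).eigenspace h = ⊤) ∧
    (∀ h : ℂ, FiniteDimensional ℂ ((ConeVOA.twistedL0 A d ta).eigenspace h)) ∧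
    ∀ τ : UpperHalfPlane,
      -- the two series converge absolutely
      Summable (ConeVOA.traceTerm (ConeVOA.twistedL0_comm_gAut A d ta b)
        ConeVOA.centralCharge τ) ∧
      Summable (fun n : Fin 2 → ℤ =>
        ConeVOA.thetaTerm A (fun i => (b i : ℝ)) c₁ c₂ τ (fun i => a i + n i)) ∧
      ConeVOA.traceFunction A d ta b τ =
        -(1 / (2 * ModularForm.eta τ ^ 2)) * ConeVOA.e (-(ConeVOA.bil A b aT : ℚ)) *
          ConeVOA.theta A a (fun i => (b i : ℝ)) c₁ c₂ τ := by
  have hA' : A = Matrix.diagonal (ConeVOA.gramDiag x p pbar) := by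
    rw [hA]
    ext i j
    fin_cases i <;> fin_cases j <;> simp [ConeVOA.gramDiag]
  have hd' : d = ConeVOA.coneGen pbar := hd
  subst hA' hd' hc₁ hc₂
  have haT' : aT = ConeVOA.aPlus (ConeVOA.coneGen pbar) ta := haT
  subst haT'
  obtain ⟨k, hk⟩ := ha
  have hT := ConeVOA.twistedL0_twistedBasis (ConeVOA.coneGen pbar) ta
    (ConeVOA.gramDiag_ne_zero hp hx)
  have hg := ConeVOA.gAut_twistedBasis (ConeVOA.coneGen pbar) ta
    (Matrix.diagonal (ConeVOA.gramDiag x p pbar)) b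
  -- The eigenvalues do not depend on `τ`, so convergence at the single point `i` suffices.
  have hfin := ConeVOA.finite_fiber_of_summable
    (ConeVOA.norm_twistedPhase (ConeVOA.coneGen pbar) ta
      (Matrix.diagonal (ConeVOA.gramDiag x p pbar)) b)
    (ConeVOA.hasSum_twistedBasis ta b UpperHalfPlane.I hta hx).summable
  refine ⟨fun v hv h0 => ConeVOA.bil_pos_of_mem_cone hx hv h0,
    ConeVOA.iSup_eigenspace_eq_top _ hT,
    fun μ => ConeVOA.finiteDimensional_eigenspace _ hT (hfin μ), fun τ => ?_⟩
  have htrace := ConeVOA.hasSum_traceTerm _ hT hg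
    (ConeVOA.twistedL0_comm_gAut _ (ConeVOA.coneGen pbar) ta b) hfin
    (ConeVOA.hasSum_twistedBasis ta b τ hta hx)
  have htheta := ConeVOA.hasSum_thetaTerm ta b τ hp hx hta hk
  refine ⟨htrace.summable, htheta.summable, ?_⟩
  rw [ConeVOA.traceFunction, htrace.tsum_eq, ConeVOA.theta, htheta.tsum_eq]
  -- The factor `-1/2` cancels the `-2` in `Θ = -2 (posSum - negSum)`.
  field_simp
  ring
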